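/- Let $\Gamma$ be a finite group acting on a compact metric space $X$ by homeomorphisms $(T_\gamma)_{\gamma\in\Gamma}$, i.e. $T:\Gamma\to\mathrm{Homeo}(X)$ is a homomorphism. Assume that the action is free: $T_\gamma(x)\neq T_{\gamma'}(x)$ for every $x\in X$ and all distinct $\gamma,\gamma'\in\Gamma$. For a finite collection $\mathcal V$ of subsets of $X$ and $x\in X$ put $\mathrm{ord}(\mathcal V,x)=-1+\sum_{V\in\mathcal V}\mathbf 1_V(x)$. Let $\mathrm{Cov}(X)$ be the set of finite open covers of $X$, write $\mathcal V\succeq\mathcal U$ if every element of $\mathcal V$ is contained in some element of $\mathcal U$, and let $\mathrm{Prob}(X,T)$ be the set of $T$-invariant Borel probability measures on $X$. For an open cover $\mathcal U$ let $$\dim(\mathcal U)=\inf_{\mathcal V\in\mathrm{Cov}(X),\,\mathcal V\succeq\mathcal U}\ \sup_{x\in X}\mathrm{ord}(\mathcal V,x),$$ let $\dim(X)=\sup_{\mathcal U\in\mathrm{Cov}(X)}\dim(\mathcal U)$ be the Lebesgue covering dimension, and let $$\dim(X,T)=\sup_{\mathcal U\in\mathrm{Cov}(X)}\ \inf_{\mathcal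 V\in\mathrm{Cov}(X),\,\mathcal V\succeq\mathcal U}\ \sup_{\mu\in\mathrm{Prob}(X,T)}\int_X\mathrm{ord}(\mathcal V,x)\,d\mu(x).$$ All values are taken in $[-\infty,+\infty]$ (with $\sup\emptyset=-\infty$, so that both dimensions are $-\infty$ for $X=\emptyset$). Then $$\dim(X,T)=\frac{1}{|\Gamma|}\dim(X).$$ Moreover, $\dim(X,T)$ equals the mean dimension of $(X,T)$: for every Følner sequence $(F_n)$ in $\Gamma$ and every $\mathcal U\in\mathrm{Cov}(X)$ the limit below exists in $[-\infty,+\infty]$, and $$\dim(X,T)=\mathrm{mdim}(X,T):=\sup_{\mathcal U\in\mathrm{Cov}(X)}\ \lim_{n\to\infty}\frac{1}{|F_n|}\dim\Big(\bigvee_{\gamma\in F_n}T_\gamma(\mathcal U)\Big),$$ where $\bigvee_{\gamma\in F}T_\gamma(\mathcal U)$ is the cover by the sets $\bigcap_{\gamma\in F}T_\gamma(U_\gamma)$ with $U_\gamma\in\mathcal U$. -/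

import Mathlib

open MeasureTheory Filter Topology

noncomputable section

namespace MeasDim

variable {X : Type*} {Γ : Type*}

/-- `𝓥` is a finite open cover of `X`. -/
def IsOpenCover [TopologicalSpace X] (𝓥 : Finset (Set X)) : Prop :=
  (∀ V ∈ 𝓥, IsOpen V) ∧ ∀ x : X, ∃ V ∈ 𝓥, x ∈ V

/-- `𝓥` refines `𝓤`: every element of `𝓥` is contained in some element of `𝓤`. -/
def Refines (𝓥 𝓤 : Set (Set X)) : Prop :=
  ∀ V ∈ 𝓥, ∃ U ∈ 𝓤, V ⊆ U

/-- The order of a finite collection at a point: `-1 + ∑_{V ∈ 𝓥} 1_V(x)`. -/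
def ordAt (𝓥 : Finset (Set X)) (x : X) : ℝ :=
  -1 + ∑ V ∈ 𝓥, V.indicator (fun _ => (1 : ℝ)) x

/-- `ord(𝓥) = sup_x ord(𝓥, x)`, which is `-∞` when `X` is empty. -/
def ord (𝓥 : Finset (Set X)) : EReal :=
  ⨆ x : X, (ordAt 𝓥 x : EReal)

/-- `dim(𝓤)`: the infimum of `ord(𝓥)` over the finite open covers `𝓥` that refine `𝓤`. -/
def coverDim [TopologicalSpace X] (𝓤 : Set (Set X)) : EReal :=
  ⨅ (𝓥 : Finset (Set X)) (_ : IsOpenCover 𝓥) (_ : Refines (𝓥 : Set (Set X)) 𝓤), ord 𝓥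

/-- The Lebesgue covering dimension, the supremum of `dim(𝓤)` over the finite open covers `𝓤`.
It is `-∞` for the empty space. -/
def coveringDim (X : Type*) [TopologicalSpace X] : EReal :=
  ⨆ (𝓤 : Finset (Set X)) (_ : IsOpenCover 𝓤), coverDim (𝓤 : Set (Set X))

/-- `ord(𝓥, P) = sup_{μ ∈ P} ∫ ord(𝓥, x) dμ(x)`, which is `-∞` when `P` is empty. -/
def ordPair [MeasurableSpace X] (𝓥 : Finset (Set X)) (P : Set (ProbabilityMeasure X)) : EReal :=
  ⨆ μ ∈ P, ((∫ x, ordAt 𝓥 x ∂(μ : Measure X) : ℝ) : EReal)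

/-- `dim(𝓤, P)`: the infimum of `ord(𝓥, P)` over the finite open covers `𝓥` that refine `𝓤`. -/
def coverDimPair [TopologicalSpace X] [MeasurableSpace X] (𝓤 : Set (Set X))
    (P : Set (ProbabilityMeasure X)) : EReal :=
  ⨅ (𝓥 : Finset (Set X)) (_ : IsOpenCover 𝓥) (_ : Refines (𝓥 : Set (Set X)) 𝓤), ordPair 𝓥 P

/-- `dim(X, P)`: the supremum of `dim(𝓤, P)` over the finite open covers `𝓤` of `X`.
It is `-∞` when `P` is empty. -/
def dimPair [TopologicalSpace X] [MeasurableSpace X] (P : Set (ProbabilityMeasure X)) : EReal :=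
  ⨆ (𝓤 : Finset (Set X)) (_ : IsOpenCover 𝓤), coverDimPair (𝓤 : Set (Set X)) P

/-- `Prob(X, T)`: the `T`-invariant Borel probability measures on `X`. -/
def invProb [TopologicalSpace X] [MeasurableSpace X] [Group Γ] (T : Γ →* (X ≃ₜ X)) :
    Set (ProbabilityMeasure X) :=
  {μ | ∀ γ : Γ, Measure.map (T γ) (μ : Measure X) = (μ : Measure X)}

/-- The dimension `dim(X, T) = dim(X, Prob(X, T))` of a dynamical system. -/
def dimSystem [TopologicalSpace X] [MeasurableSpace X] [Group Γ] (T : Γ →* (X ≃ₜ X)) : EReal :=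
  dimPair (invProb T)

/-- The action is free: distinct group elements move every point to distinct points. -/
def IsFreeAction [TopologicalSpace X] [Group Γ] (T : Γ →* (X ≃ₜ X)) : Prop :=
  ∀ (x : X) (γ γ' : Γ), γ ≠ γ' → T γ x ≠ T γ' x

/-- The joint refinement `⋁_{γ ∈ F} T_γ(𝓤)`: all sets `⋂_{γ ∈ F} T_γ(U_γ)` with `U_γ ∈ 𝓤`. -/
def join [TopologicalSpace X] [Group Γ] (T : Γ →* (X ≃ₜ X)) (F : Finset Γ)
    (𝓤 : Set (Set X)) : Set (Set X) :=
  {W | ∃ U : Γ → Set X, (∀ γ ∈ F, U γ ∈ 𝓤) ∧ W = ⋂ γ ∈ F, T γ '' U γ}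

/-- A Følner sequence of finite subsets of the discrete group `Γ`: the sets are eventually
nonempty, and `|γ F_n ∆ F_n| / |F_n|` tends to `0` for every `γ`. -/
def IsFolnerSeq [Group Γ] (F : ℕ → Finset Γ) : Prop :=
  letI : MeasurableSpace Γ := ⊤
  IsFoelner Γ (Measure.count : Measure Γ) atTop (fun n => (F n : Set Γ))

/-- The quantity `|F|⁻¹ dim(⋁_{γ ∈ F} T_γ(𝓤))`. -/
def avgCoverDim [TopologicalSpace X] [Group Γ] (T : Γ →* (X ≃ₜ X)) (𝓤 : Set (Set X))
    (F : Finset Γ) : EReal :=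
  coverDim (join T F 𝓤) / (F.card : EReal)

/-- Mean dimension computed along the sequence `F`: the supremum over the finite open covers `𝓤`
of the upper limit of `|F_n|⁻¹ dim(⋁_{γ ∈ F_n} T_γ(𝓤))`. When these sequences converge, as they do
along Følner sequences, the upper limit is the limit. -/
def meanDim [TopologicalSpace X] [Group Γ] (T : Γ →* (X ≃ₜ X)) (F : ℕ → Finset Γ) : EReal :=
  ⨆ (𝓤 : Finset (Set X)) (_ : IsOpenCover 𝓤),
    limsup (fun n => avgCoverDim T (𝓤 : Set (Set X)) (F n)) atTop

end MeasDim

end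

namespace MeasDim

/-! Both inequalities compare the covering dimension with sums of multiplicities along orbits:
integrating against an invariant measure averages over orbits, and uniform measures on orbits are
invariant.

For `coveringDim X / |Γ| ≤ dimSystem T`, the translates of a cover by all `γ` have a common
refinement whose order is at most the largest orbit sum of orders (`exists_refinement_multAt_le`).
The orbit where that sum is attained carries a measure witnessing the bound. Freeness plays no role
here.

For the converse, let `n` bound the dimension. Freeness gives small open sets disjoint from their
nontrivial translates, which can be shrunk until all translates together have multiplicity at most
`n + 1`. Weight bump functions on the translates by exponentials of rationally independent numbers
and let each point select the functions that are maximal there. Along one orbit, the selections are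
the edges of a bipartite graph joining the `|Γ|` group elements to the at most `n + 1` translates
containing the base point. Taking logarithms, each edge carries an independent number equal to a
difference of vertex values, so the graph is a forest with at most `|Γ| + n` edges. Compactness
thickens the selections to an open cover with orbit sums of orders at most `n`.

In a finite group a Følner sequence is eventually the whole group, so mean dimension is also
`coveringDim X / |Γ|`. -/

/-! ### Rational independence and forests -/

theorem exists_linearIndependent_rat_real (ι : Type*) [Finite ι] :
    ∃ v : ι → ℝ, LinearIndependent ℚ v := by
  let B := Module.Basis.ofVectorSpace ℚ ℝ
  have hB : Infinite (Module.Basis.ofVectorSpaceIndex ℚ ℝ) := by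
    rw [Cardinal.infinite_iff, B.mk_eq_rank'', Real.rank_rat_real]
    exact Cardinal.aleph0_le_continuum
  have := Fintype.ofFinite ι
  let e : ι ↪ Module.Basis.ofVectorSpaceIndex ℚ ℝ :=
    (Fintype.equivFin ι).toEmbedding.trans
      (Fin.valEmbedding.trans (Infinite.natEmbedding _))
  exact ⟨B ∘ e, B.linearIndependent.comp e e.injective⟩

/-- Numbers `m a - y b` indexed by the edges of a bipartite graph can only be rationally
independent if the graph is a forest. -/
theorem card_succ_le_of_linearIndependent_sub {α β ε : Type*} [Fintype α] [Fintype β] [Fintype ε]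
    [Nonempty β] (a : ε → α) (b : ε → β) (m : α → ℝ) (y : β → ℝ)
    (h : LinearIndependent ℚ fun e => m (a e) - y (b e)) :
    Fintype.card ε + 1 ≤ Fintype.card α + Fintype.card β := by
  classical
  obtain ⟨b₀⟩ := ‹Nonempty β›
  -- Edge values are unchanged when a constant is added to all vertex values, so normalising at `b₀`
  -- saves one dimension.
  let w : Finset ℝ := Finset.univ.image (fun i => m i - y b₀) ∪
    (Finset.univ.erase b₀).image (fun j => y j - y b₀)
  have hw : w.card ≤ Fintype.card α + (Fintype.card β - 1) := by
    refine (Finset.card_union_le _ _).trans (add_le_add Finset.card_image_le ?_)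
    refine Finset.card_image_le.trans ?_
    rw [Finset.card_erase_of_mem (Finset.mem_univ _), Finset.card_univ]
  have hs : Set.range (fun e => m (a e) - y (b e)) ≤ Submodule.span ℚ (w : Set ℝ) := by
    rintro _ ⟨e, rfl⟩
    have h1 : m (a e) - y b₀ ∈ Submodule.span ℚ (w : Set ℝ) := by
      apply Submodule.subset_span
      simp only [w, Finset.coe_union, Finset.coe_image]
      exact Or.inl ⟨a e, by simp, rfl⟩
    have h2 : y (b e) - y b₀ ∈ Submodule.span ℚ (w : Set ℝ) := by
      by_cases hb : b e = b₀
      · simp [hb]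
      · apply Submodule.subset_span
        simp only [w, Finset.coe_union, Finset.coe_image]
        exact Or.inr ⟨b e, by simp [hb], rfl⟩
    have := sub_mem h1 h2
    simpa using this
  have := linearIndependent_le_span' _ h (w : Set ℝ) hs
  rw [Cardinal.mk_fintype] at this
  have h3 : Fintype.card ε ≤ w.card := by simpa using this
  have : 0 < Fintype.card β := Fintype.card_pos_iff.2 ⟨b₀⟩
  omega

/-! ### Multiplicity of indexed families -/

variable {X : Type*} {Γ : Type*}

open scoped Classical in
/-- The number of indices `j` with `x ∈ A j`. -/
noncomputable def multAt {J : Type*} [Fintype J] (A : J → Set X) (x : X) : ℕ :=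
  (Finset.univ.filter fun j => x ∈ A j).card

open scoped Classical in
theorem multAt_mono {J : Type*} [Fintype J] {A B : J → Set X} {x y : X}
    (h : ∀ j, x ∈ A j → y ∈ B j) : multAt A x ≤ multAt B y :=
  Finset.card_le_card fun j hj => by
    simp only [Finset.mem_filter, Finset.mem_univ, true_and] at hj ⊢
    exact h j hj

theorem multAt_eq_card {J : Type*} [Fintype J] (A : J → Set X) (x : X)
    [Fintype {j // x ∈ A j}] : multAt A x = Fintype.card {j // x ∈ A j} := by
  classical
  exact (Fintype.card_of_subtype _ fun j => by simp).symm

open scoped Classical in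
theorem multAt_pos {J : Type*} [Fintype J] {A : J → Set X} {x : X} {j : J} (h : x ∈ A j) :
    0 < multAt A x :=
  Finset.card_pos.2 ⟨j, by simpa using h⟩

open scoped Classical in
theorem multAt_prod {J K : Type*} [Fintype J] [Fintype K] (A : J × K → Set X) (x : X) :
    multAt A x = ∑ j, multAt (fun k => A (j, k)) x := by
  simp only [multAt, Finset.card_filter]
  rw [Fintype.sum_prod_type]

open scoped Classical in
theorem ordAt_eq (𝓥 : Finset (Set X)) (x : X) :
    ordAt 𝓥 x = (multAt (fun V : 𝓥 => (V : Set X)) x : ℝ) - 1 := by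
  rw [ordAt, multAt, Finset.card_filter]
  simp only [Nat.cast_sum, Nat.cast_ite, Nat.cast_one, Nat.cast_zero]
  rw [Finset.sum_coe_sort 𝓥 (fun V => if x ∈ V then (1 : ℝ) else 0), neg_add_eq_sub]
  congr 1

open scoped Classical in
-- Only an inequality: equal sets with different indices merge in the image.
theorem multAt_coe_image_le {J : Type*} [Fintype J] (A : J → Set X) (x : X) :
    multAt (fun V : (Finset.univ.image A : Finset (Set X)) => (V : Set X)) x ≤ multAt A x := by
  choose f hf using fun V : (Finset.univ.image A : Finset (Set X)) =>
    show ∃ j, A j = V by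
      obtain ⟨j, -, hj⟩ := Finset.mem_image.1 V.2
      exact ⟨j, hj⟩
  refine Finset.card_le_card_of_injOn f (fun V hV => ?_) (fun V _ W _ h => ?_)
  · simpa [hf] using hV
  · rw [← Subtype.coe_inj, ← hf V, ← hf W, h]

open scoped Classical in
theorem isOpenCover_image [TopologicalSpace X] {J : Type*} [Fintype J] {A : J → Set X}
    (hA : ∀ j, IsOpen (A j)) (hcov : ∀ x, ∃ j, x ∈ A j) :
    IsOpenCover (Finset.univ.image A) := by
  refine ⟨by simpa using hA, fun x => ?_⟩
  obtain ⟨j, hj⟩ := hcov x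
  exact ⟨A j, by simp, hj⟩

/-! ### Shrinking, thickening and common refinement -/

open scoped Classical in
/-- If every finite open cover has a refinement of multiplicity at most `n`, then so has every
indexed finite open cover, with the same index set. -/
theorem exists_shrinking_of_exists_refinement [TopologicalSpace X] {n : ℕ}
    (H : ∀ 𝓤 : Finset (Set X), IsOpenCover 𝓤 → ∃ 𝓥 : Finset (Set X), IsOpenCover 𝓥 ∧
      Refines (𝓥 : Set (Set X)) 𝓤 ∧ ∀ x, multAt (fun V : 𝓥 => (V : Set X)) x ≤ n)
    {J : Type*} [Fintype J] {A : J → Set X}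
    (hA : ∀ j, IsOpen (A j)) (hcov : ∀ x, ∃ j, x ∈ A j) :
    ∃ B : J → Set X, (∀ j, IsOpen (B j)) ∧ (∀ j, B j ⊆ A j) ∧ (∀ x, ∃ j, x ∈ B j) ∧
      ∀ x, multAt B x ≤ n := by
  obtain ⟨𝓥, h𝓥, href, hn⟩ := H _ (isOpenCover_image hA hcov)
  choose f hf using fun V : 𝓥 => show ∃ j, (V : Set X) ⊆ A j by
    obtain ⟨U, hU, hVU⟩ := href V V.2
    obtain ⟨j, rfl⟩ : ∃ j, A j = U := by simpa using hU
    exact ⟨j, hVU⟩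
  refine ⟨fun j => ⋃ (V : 𝓥) (_ : f V = j), V, fun j => ?_, fun j => ?_, fun x => ?_,
    fun x => le_trans ?_ (hn x)⟩
  · exact isOpen_iUnion fun V => isOpen_iUnion fun _ => h𝓥.1 V V.2
  · exact Set.iUnion₂_subset fun V hV => hV ▸ hf V
  · obtain ⟨V, hV, hx⟩ := h𝓥.2 x
    exact ⟨f ⟨V, hV⟩, Set.mem_iUnion₂.2 ⟨⟨V, hV⟩, rfl, hx⟩⟩
  · refine le_trans (Finset.card_le_card ?_) (Finset.card_image_le (f := f))
    intro j hj
    simp only [Finset.mem_filter, Finset.mem_univ, true_and, Set.mem_iUnion] at hj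
    obtain ⟨V, rfl, hx⟩ := hj
    exact Finset.mem_image_of_mem _ (by simpa using hx)

/-- In a compact space, finitely many closed sets given as zero sets of nonnegative functions can
be thickened without increasing the bound on their multiplicity. -/
theorem eventually_multAt_lt_le [TopologicalSpace X] [CompactSpace X] {J : Type*} [Fintype J]
    {h : J → X → ℝ} (hc : ∀ j, Continuous (h j)) (h0 : ∀ j x, 0 ≤ h j x) {n : ℕ}
    (hn : ∀ x, multAt (fun j => {x | h j x = 0}) x ≤ n) :
    ∀ᶠ ε in 𝓝[>] (0 : ℝ), ∀ x, multAt (fun j => {x | h j x < ε}) x ≤ n := by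
  classical
  rcases isEmpty_or_nonempty X with hX | hX
  · simp
  -- No `n + 1` of the functions vanish together, so their maximum is positive everywhere and, by
  -- compactness, bounded away from zero.
  have key : ∀ σ ∈ (Finset.univ : Finset J).powersetCard (n + 1),
      ∀ᶠ ε in 𝓝[>] (0 : ℝ), ∀ x, ∃ j ∈ σ, ε ≤ h j x := by
    intro σ hσ
    have hσc := (Finset.mem_powersetCard.1 hσ).2
    have hne : σ.Nonempty := Finset.card_pos.1 (by omega)
    have hcont : Continuous fun x => σ.sup' hne fun j => h j x :=
      Continuous.finset_sup'_apply hne fun j _ => hc j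
    obtain ⟨x₀, -, hx₀⟩ := isCompact_univ.exists_isMinOn Set.univ_nonempty hcont.continuousOn
    have hpos : 0 < σ.sup' hne fun j => h j x₀ := by
      by_contra hcon
      have hz : ∀ j ∈ σ, h j x₀ = 0 := fun j hj =>
        le_antisymm ((Finset.le_sup' (fun j => h j x₀) hj).trans (not_lt.1 hcon)) (h0 j x₀)
      have : σ.card ≤ multAt (fun j => {x | h j x = 0}) x₀ :=
        Finset.card_le_card fun j hj => by simpa using hz j hj
      have := hn x₀
      omega
    filter_upwards [Ioo_mem_nhdsGT hpos] with ε hε x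
    obtain ⟨j, hj, hjx⟩ := Finset.exists_mem_eq_sup' hne fun j => h j x
    exact ⟨j, hj, hjx ▸ hε.2.le.trans (hx₀ (Set.mem_univ x))⟩
  filter_upwards [(Filter.eventually_all_finset _).2 key] with ε hε x
  by_contra! hcon
  obtain ⟨σ, hσ, hσc⟩ := Finset.exists_subset_card_eq (Nat.succ_le_of_lt hcon)
  obtain ⟨j, hj, hjx⟩ := hε σ (Finset.mem_powersetCard.2 ⟨Finset.subset_univ _, hσc⟩) x
  have := hσ hj
  simp only [Finset.mem_filter, Finset.mem_univ, true_and, Set.mem_ofPred_eq] at this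
  linarith

/-- A common refinement of finitely many open covers whose order is bounded by the sum of their
orders. -/
theorem exists_refinement_multAt_le [TopologicalSpace X] [NormalSpace X] {ι κ : Type*} [Fintype ι]
    [Fintype κ] {A : ι × κ → Set X} (hA : ∀ p, IsOpen (A p)) (hcov : ∀ i x, ∃ k, x ∈ A (i, k))
    {n : ℕ} (hn : ∀ x, multAt A x ≤ n + Fintype.card ι) :
    ∃ 𝓦 : Finset (Set X), IsOpenCover 𝓦 ∧ (∀ W ∈ 𝓦, ∀ i, ∃ k, W ⊆ A (i, k)) ∧
      ∀ x, multAt (fun W : 𝓦 => (W : Set X)) x ≤ n + 1 := by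
  classical
  choose C hC hCc hCA using fun i : ι => exists_iUnion_eq_closed_subset
    (fun k => hA (i, k)) (fun x => Set.toFinite _)
    (Set.eq_univ_of_forall fun x => Set.mem_iUnion.2 (hcov i x))
  choose f hf0 hf1 hf using fun p : ι × κ => exists_continuous_zero_one_of_isClosed
    (hA p).isClosed_compl (hCc p.1 p.2)
    (Set.disjoint_left.2 fun x hx hx' => hx (hCA p.1 p.2 hx'))
  -- As in barycentric subdivision, `U σ` is where the values indexed by `σ` are positive and exceed
  -- all others. Requiring `σ` to meet every block makes `U σ` refine each of the covers.
  let S := {σ : Finset (ι × κ) // ∀ i, ∃ k, (i, k) ∈ σ}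
  let U : S → Set X := fun σ =>
    {x | (∀ p ∈ σ.1, 0 < f p x) ∧ ∀ p ∈ σ.1, ∀ q ∈ σ.1ᶜ, f q x < f p x}
  have hUo : ∀ σ, IsOpen (U σ) := by
    intro σ
    simp only [U, Set.ofPred_and, Set.ofPred_forall]
    refine IsOpen.inter ?_ ?_
    · exact isOpen_biInter_finset fun p _ => isOpen_lt continuous_const (f p).continuous
    · exact isOpen_biInter_finset fun p _ => isOpen_biInter_finset fun q _ =>
        isOpen_lt (f q).continuous (f p).continuous
  have hUA : ∀ σ x, x ∈ U σ → ∀ p ∈ σ.1, x ∈ A p := by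
    intro σ x hx p hp
    by_contra hcon
    exact (hx.1 p hp).ne' (hf0 p hcon)
  refine ⟨Finset.univ.image U, isOpenCover_image hUo fun x => ?_, ?_, fun x =>
    (multAt_coe_image_le U x).trans ?_⟩
  -- The indices where the maximal value 1 is attained meet each block, because the closed
  -- shrinkings `C i` cover.
  · refine ⟨⟨Finset.univ.filter fun p => f p x = 1, fun i => ?_⟩, fun p hp => ?_,
      fun p hp q hq => ?_⟩
    · obtain ⟨k, hk⟩ := Set.mem_iUnion.1 ((hC i).symm ▸ Set.mem_univ x)
      exact ⟨k, by simpa using hf1 (i, k) hk⟩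
    · have : f p x = 1 := by simpa using hp
      simp [this]
    · have h1 : f p x = 1 := by simpa using hp
      have h2 : f q x ≠ 1 := by simpa using hq
      rw [h1]
      exact lt_of_le_of_ne (hf q x).2 h2
  · intro W hW i
    obtain ⟨σ, rfl⟩ : ∃ σ, U σ = W := by simpa using hW
    obtain ⟨k, hk⟩ := σ.2 i
    exact ⟨k, fun x hx => hUA σ x hx _ hk⟩
  -- The `σ` with `x ∈ U σ` have distinct sizes: of two different ones of equal size, each would
  -- have an index whose value exceeds the other's.
  · have hcard : (Finset.Icc (Fintype.card ι) (n + Fintype.card ι)).card = n + 1 := by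
      simp; omega
    rw [← hcard]
    refine Finset.card_le_card_of_injOn (fun σ => σ.1.card) (fun σ hσ => ?_)
      (fun σ hσ τ hτ h => ?_)
    · have hσ : x ∈ U σ := by simpa using hσ
      simp only [Finset.coe_Icc, Set.mem_Icc]
      constructor
      · choose g hg using σ.2
        rw [← Finset.card_univ]
        exact Finset.card_le_card_of_injOn (fun i => (i, g i)) (fun i _ => hg i)
          (fun i _ j _ h => congrArg Prod.fst h)
      · exact (Finset.card_le_card fun p hp => by simpa using hUA σ x hσ p hp).trans (hn x)
    · have hσ : x ∈ U σ := by simpa using hσ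
      have hτ : x ∈ U τ := by simpa using hτ
      by_contra hne
      have hne' : σ.1 ≠ τ.1 := fun h => hne (Subtype.ext h)
      obtain ⟨p, hp, hp'⟩ := Finset.not_subset.1 fun hs =>
        hne' (Finset.eq_of_subset_of_card_le hs h.ge)
      obtain ⟨q, hq, hq'⟩ := Finset.not_subset.1 fun hs =>
        hne' (Finset.eq_of_subset_of_card_le hs h.le).symm
      exact lt_asymm (hσ.2 p hp q (by simpa using hq')) (hτ.2 q hq p (by simpa using hp'))

/-! ### Covering dimension and Følner averages in a finite group -/

theorem Refines.trans {𝓤 𝓥 𝓦 : Set (Set X)} (h : Refines 𝓦 𝓥) (h' : Refines 𝓥 𝓤) :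
    Refines 𝓦 𝓤 := fun W hW => by
  obtain ⟨V, hV, hWV⟩ := h W hW
  obtain ⟨U, hU, hVU⟩ := h' V hV
  exact ⟨U, hU, hWV.trans hVU⟩

theorem coverDim_mono [TopologicalSpace X] {𝓤 𝓥 : Set (Set X)} (h : Refines 𝓥 𝓤) :
    coverDim 𝓤 ≤ coverDim 𝓥 :=
  le_iInf₂ fun 𝓦 h𝓦 => le_iInf fun href => iInf₂_le_of_le 𝓦 h𝓦 (iInf_le _ (href.trans h))

theorem coverDim_le_coveringDim [TopologicalSpace X] {𝓤 : Finset (Set X)} (h : IsOpenCover 𝓤) :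
    coverDim (𝓤 : Set (Set X)) ≤ coveringDim X :=
  le_iSup₂_of_le 𝓤 h le_rfl

open scoped Pointwise in
/-- Along a Følner sequence in a finite group, the sets are eventually the whole group. -/
theorem IsFolnerSeq.eventually_eq_univ [Group Γ] [Fintype Γ] {F : ℕ → Finset Γ}
    (hF : IsFolnerSeq F) : ∀ᶠ n in atTop, F n = Finset.univ := by
  classical
  let _ : MeasurableSpace Γ := ⊤
  have : DiscreteMeasurableSpace Γ := ⟨fun _ => trivial⟩
  have hcnt : ∀ s : Finset Γ, Measure.count (s : Set Γ) = s.card := Measure.count_apply_finset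
  have hF' : IsFoelner Γ (Measure.count : Measure Γ) atTop (fun n => (F n : Set Γ)) := hF
  -- A nonempty symmetric difference has ratio at least `1 / |Γ|`, so below this threshold `F n` is
  -- invariant.
  have hsmall : ∀ g : Γ, ∀ᶠ n in atTop,
      Measure.count (symmDiff (g • (F n : Set Γ)) (F n)) / Measure.count (F n : Set Γ) <
        (Fintype.card Γ : ENNReal)⁻¹ := fun g =>
    (hF'.tendsto_meas_smul_symmDiff g).eventually_lt_const (by simp)
  filter_upwards [hF'.eventually_meas_ne_zero, Filter.eventually_all.2 hsmall] with n h0 hn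
  rw [hcnt] at h0
  have hne : (F n).Nonempty := by
    rw [← Finset.card_pos, Nat.pos_iff_ne_zero]
    exact_mod_cast h0
  have hinv : ∀ g : Γ, g • (F n : Set Γ) = F n := by
    intro g
    by_contra hcon
    have hsd : (symmDiff (g • (F n : Set Γ)) (F n)).Nonempty := by
      rwa [Set.nonempty_iff_ne_empty, Ne, ← Set.bot_eq_empty, symmDiff_eq_bot]
    obtain ⟨a, ha⟩ := hsd
    have h1 : 1 ≤ Measure.count (symmDiff (g • (F n : Set Γ)) (F n)) := by
      rw [← Measure.count_singleton a]
      exact measure_mono (Set.singleton_subset_iff.2 ha)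
    refine (hn g).not_ge ?_
    rw [hcnt, ← one_div]
    exact ENNReal.div_le_div h1 (by exact_mod_cast Finset.card_le_univ _)
  obtain ⟨a, ha⟩ := hne
  refine Finset.eq_univ_of_forall fun b => ?_
  have : b ∈ (b * a⁻¹) • (F n : Set Γ) := ⟨a, ha, by simp⟩
  rwa [hinv, Finset.mem_coe] at this

theorem iSup_div_natCast {ι : Sort*} {p : ι → Prop} (f : ι → EReal) {n : ℕ} (hn : 0 < n) :
    ⨆ (i) (_ : p i), f i / (n : EReal) = (⨆ (i) (_ : p i), f i) / (n : EReal) := by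
  have h0 : (0 : EReal) < n := by exact_mod_cast hn
  have ht : (n : EReal) ≠ ⊤ := EReal.natCast_ne_top n
  apply le_antisymm
  · exact iSup₂_le fun i hi => EReal.div_le_div_right_of_nonneg h0.le (le_iSup₂_of_le i hi le_rfl)
  · rw [EReal.div_le_iff_le_mul h0 ht]
    refine iSup₂_le fun i hi => ?_
    rw [← EReal.div_le_iff_le_mul h0 ht]
    exact le_iSup₂_of_le (f := fun i _ => f i / (n : EReal)) i hi le_rfl

open scoped Classical in
theorem exists_isOpenCover_coe_eq_join [TopologicalSpace X] [Group Γ] [Fintype Γ]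
    (T : Γ →* (X ≃ₜ X)) {𝓤 : Finset (Set X)} (h𝓤 : IsOpenCover 𝓤) :
    ∃ 𝓦 : Finset (Set X), IsOpenCover 𝓦 ∧ (𝓦 : Set (Set X)) = join T Finset.univ 𝓤 := by
  refine ⟨Finset.univ.image fun U : Γ → 𝓤 => ⋂ γ, T γ '' (U γ : Set X),
    isOpenCover_image (fun U => ?_) (fun x => ?_), ?_⟩
  · exact isOpen_iInter_of_finite fun γ => (T γ).isOpenMap _ (h𝓤.1 _ (U γ).2)
  · choose U hU hx using fun γ => h𝓤.2 ((T γ).symm x)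
    exact ⟨fun γ => ⟨U γ, hU γ⟩, Set.mem_iInter.2 fun γ => ⟨_, hx γ, by simp⟩⟩
  · ext W
    simp only [Finset.coe_image, Finset.coe_univ, Set.image_univ, Set.mem_range, join,
      Finset.mem_univ, Set.iInter_true, Set.mem_ofPred_eq, forall_const]
    constructor
    · rintro ⟨U, rfl⟩
      exact ⟨fun γ => U γ, fun γ => (U γ).2, rfl⟩
    · rintro ⟨U, hU, rfl⟩
      exact ⟨fun γ => ⟨U γ, hU γ⟩, rfl⟩

theorem refines_join [TopologicalSpace X] [Group Γ] [Fintype Γ]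
    (T : Γ →* (X ≃ₜ X)) (𝓤 : Set (Set X)) : Refines (join T Finset.univ 𝓤) 𝓤 := by
  rintro _ ⟨U, hU, rfl⟩
  refine ⟨U 1, hU 1 (Finset.mem_univ _), fun x hx => ?_⟩
  obtain ⟨y, hy, rfl⟩ := Set.mem_iInter₂.1 hx 1 (Finset.mem_univ _)
  simpa using hy

theorem tendsto_avgCoverDim [TopologicalSpace X] [Group Γ] [Fintype Γ] (T : Γ →* (X ≃ₜ X))
    {F : ℕ → Finset Γ} (hF : IsFolnerSeq F) (𝓤 : Set (Set X)) :
    Tendsto (fun n => avgCoverDim T 𝓤 (F n)) atTop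
      (𝓝 (coverDim (join T Finset.univ 𝓤) / (Fintype.card Γ : EReal))) := by
  refine tendsto_const_nhds.congr' ?_
  filter_upwards [hF.eventually_eq_univ] with n hn
  rw [hn, avgCoverDim, Finset.card_univ]

/-- The join over all of `Γ` is itself a finite open cover and refines `𝓤`, so passing to joins does
not change the supremum. -/
theorem meanDim_eq_coveringDim_div [TopologicalSpace X] [Group Γ] [Fintype Γ] (T : Γ →* (X ≃ₜ X))
    {F : ℕ → Finset Γ} (hF : IsFolnerSeq F) :
    meanDim T F = coveringDim X / (Fintype.card Γ : EReal) := by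
  have : meanDim T F = ⨆ (𝓤 : Finset (Set X)) (_ : IsOpenCover 𝓤),
      coverDim (join T Finset.univ (𝓤 : Set (Set X))) / (Fintype.card Γ : EReal) :=
    iSup_congr fun 𝓤 => iSup_congr fun _ => (tendsto_avgCoverDim T hF _).limsup_eq
  rw [this, iSup_div_natCast _ Fintype.card_pos]
  congr 1
  apply le_antisymm
  · refine iSup₂_le fun 𝓤 h𝓤 => ?_
    obtain ⟨𝓦, h𝓦, heq⟩ := exists_isOpenCover_coe_eq_join T h𝓤
    exact heq ▸ coverDim_le_coveringDim h𝓦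
  · exact iSup₂_mono fun 𝓤 _ => coverDim_mono (refines_join T _)

/-! ### Invariant measures -/

section Measure

variable [TopologicalSpace X] [MeasurableSpace X] [BorelSpace X] [Group Γ] [Fintype Γ]
  (T : Γ →* (X ≃ₜ X))

theorem integrable_ordAt {𝓥 : Finset (Set X)} (h : IsOpenCover 𝓥) (μ : Measure X)
    [IsFiniteMeasure μ] : Integrable (ordAt 𝓥) μ :=
  (integrable_const _).add <| integrable_finsetSum _ fun V hV =>
    (integrable_const _).indicator (h.1 V hV).measurableSet

/-- By invariance every `γ` contributes the same integral to the orbit sum. -/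
theorem integral_ordAt_le_of_mem_invProb {𝓥 : Finset (Set X)} (h : IsOpenCover 𝓥)
    {μ : ProbabilityMeasure X} (hμ : μ ∈ invProb T) {r : ℝ}
    (hr : ∀ x, ∑ γ, ordAt 𝓥 (T γ x) ≤ r) :
    ∫ x, ordAt 𝓥 x ∂(μ : Measure X) ≤ r / Fintype.card Γ := by
  have hmp : ∀ γ, MeasurePreserving (T γ) (μ : Measure X) (μ : Measure X) :=
    fun γ => ⟨(T γ).measurable, hμ γ⟩
  have hint : ∀ γ, Integrable (fun x => ordAt 𝓥 (T γ x)) (μ : Measure X) := fun γ =>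
    (hmp γ).integrable_comp_of_integrable (integrable_ordAt h _)
  have heq : ∀ γ, ∫ x, ordAt 𝓥 (T γ x) ∂(μ : Measure X) = ∫ x, ordAt 𝓥 x ∂(μ : Measure X) :=
    fun γ => (hmp γ).integral_comp (T γ).measurableEmbedding _
  have hsum : ∫ x, ∑ γ, ordAt 𝓥 (T γ x) ∂(μ : Measure X) =
      Fintype.card Γ * ∫ x, ordAt 𝓥 x ∂(μ : Measure X) := by
    rw [integral_finsetSum _ fun γ _ => hint γ]
    simp [heq]
  have hle : ∫ x, ∑ γ, ordAt 𝓥 (T γ x) ∂(μ : Measure X) ≤ ∫ _, r ∂(μ : Measure X) :=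
    integral_mono (integrable_finsetSum _ fun γ _ => hint γ) (integrable_const _) hr
  rw [hsum] at hle
  have hc : (0 : ℝ) < Fintype.card Γ := by exact_mod_cast Fintype.card_pos
  rw [le_div_iff₀ hc, mul_comm]
  simpa using hle

/-- The uniform measure on an orbit is invariant. -/
theorem exists_mem_invProb_integral_ordAt_eq {𝓥 : Finset (Set X)} (h : IsOpenCover 𝓥) (x : X) :
    ∃ μ ∈ invProb T, ∫ y, ordAt 𝓥 y ∂(μ : Measure X) =
      (∑ γ, ordAt 𝓥 (T γ x)) / Fintype.card Γ := by
  have hc : (Fintype.card Γ : ENNReal) ≠ 0 := by simp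
  let ν : Measure X := (Fintype.card Γ : ENNReal)⁻¹ • ∑ γ, Measure.dirac (T γ x)
  have hν : IsProbabilityMeasure ν := ⟨by
    simp only [ν, Measure.smul_apply, Measure.finsetSum_apply, measure_univ, smul_eq_mul,
      Finset.sum_const, Finset.card_univ, nsmul_eq_mul, mul_one]
    exact ENNReal.inv_mul_cancel hc (by simp)⟩
  refine ⟨⟨ν, hν⟩, fun δ => ?_, ?_⟩
  · change Measure.map (T δ) ν = ν
    simp only [ν, Measure.map_smul]
    congr 1
    rw [← Measure.mapₗ_apply_of_measurable (T δ).measurable, map_sum]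
    refine Fintype.sum_equiv (Equiv.mulLeft δ) _ _ fun γ => ?_
    rw [Measure.mapₗ_apply_of_measurable (T δ).measurable, Measure.map_dirac' (T δ).measurable]
    simp
  · change ∫ y, ordAt 𝓥 y ∂ν = _
    rw [integral_smul_measure, integral_finsetSum_measure fun γ _ => integrable_ordAt h _]
    have hm : StronglyMeasurable (ordAt 𝓥) := 
      (measurable_const.add <| Finset.measurable_fun_sum _ fun V hV =>
        measurable_const.indicator (h.1 V hV).measurableSet).stronglyMeasurable
    simp only [integral_dirac' _ _ hm]
    simp [div_eq_inv_mul]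

/-- The worst orbit sum controls the order of a common refinement of all translates, and the uniform
measure on that orbit realises it as an integral. -/
theorem coverDim_div_card_le [NormalSpace X] [Nonempty X] {𝓥 : Finset (Set X)}
    (h : IsOpenCover 𝓥) :
    coverDim (𝓥 : Set (Set X)) / (Fintype.card Γ : EReal) ≤ ordPair 𝓥 (invProb T) := by
  classical
  let A : Γ × 𝓥 → Set X := fun p => T p.1 ⁻¹' p.2
  have hAo : ∀ p, IsOpen (A p) := fun p => (h.1 _ p.2.2).preimage (T p.1).continuous
  have hcov : ∀ γ x, ∃ V, x ∈ A (γ, V) := fun γ x => by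
    obtain ⟨V, hV, hx⟩ := h.2 (T γ x)
    exact ⟨⟨V, hV⟩, hx⟩
  have hbdd : (Set.range (multAt A)).Finite :=
    (Set.finite_Iic (Fintype.card (Γ × 𝓥))).subset (by
      rintro _ ⟨x, rfl⟩
      exact Finset.card_le_univ _)
  -- The multiplicity takes finitely many values, so its maximum is attained.
  obtain ⟨_, ⟨x₀, rfl⟩, hx₀⟩ := hbdd.exists_maximal (Set.range_nonempty _)
  have hmax : ∀ x, multAt A x ≤ multAt A x₀ := fun x =>
    not_lt.1 fun hlt => hlt.not_ge (hx₀ ⟨x, rfl⟩ hlt.le)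
  have hge : Fintype.card Γ ≤ multAt A x₀ := by
    rw [multAt_prod, ← Finset.card_univ, Finset.card_eq_sum_ones]
    exact Finset.sum_le_sum fun γ _ => multAt_pos (hcov γ x₀).choose_spec
  obtain ⟨n, hn⟩ := Nat.exists_eq_add_of_le' hge
  obtain ⟨𝓦, h𝓦, href, hle⟩ := exists_refinement_multAt_le hAo hcov fun x => (hmax x).trans hn.le
  have hsum : ∑ γ, ordAt 𝓥 (T γ x₀) = n := by
    have : (∑ γ, multAt (fun V => A (γ, V)) x₀ : ℝ) = n + Fintype.card Γ := by
      rw [multAt_prod] at hn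
      exact_mod_cast hn
    simp only [ordAt_eq, Finset.sum_sub_distrib]
    rw [show (∑ γ, (multAt (fun V : 𝓥 => (V : Set X)) (T γ x₀) : ℝ)) =
      ∑ γ, (multAt (fun V => A (γ, V)) x₀ : ℝ) from rfl, this]
    simp
  have hdim : coverDim (𝓥 : Set (Set X)) ≤ ((n : ℝ) : EReal) := by
    refine iInf₂_le_of_le 𝓦 h𝓦 (iInf_le_of_le ?_ (iSup_le fun x => ?_))
    · intro W hW
      obtain ⟨V, hV⟩ := href W hW 1
      refine ⟨V, V.2, fun x hx => ?_⟩
      simpa [A] using hV hx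
    · rw [EReal.coe_le_coe_iff, ordAt_eq, sub_le_iff_le_add]
      exact_mod_cast hle x
  obtain ⟨μ, hμ, hint⟩ := exists_mem_invProb_integral_ordAt_eq T h x₀
  refine (EReal.div_le_div_right_of_nonneg (by positivity) hdim).trans (le_iSup₂_of_le μ hμ ?_)
  rw [hint, hsum, EReal.coe_div]
  simp

theorem coveringDim_div_card_le_dimSystem [NormalSpace X] :
    coveringDim X / (Fintype.card Γ : EReal) ≤ dimSystem T := by
  rw [coveringDim, ← iSup_div_natCast _ Fintype.card_pos]
  have hc : (0 : EReal) < Fintype.card Γ := by exact_mod_cast Fintype.card_pos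
  refine iSup₂_mono fun 𝓤 h𝓤 => le_iInf₂ fun 𝓥 h𝓥 => le_iInf fun href => ?_
  rcases isEmpty_or_nonempty X with hX | hX
  · have : coverDim (𝓤 : Set (Set X)) = ⊥ :=
      le_bot_iff.1 (iInf₂_le_of_le 𝓤 h𝓤 (iInf_le_of_le (fun V hV => ⟨V, hV, le_rfl⟩) (by simp [ord])))
    rw [this, EReal.bot_div_of_pos_ne_top hc (EReal.natCast_ne_top _)]
    exact bot_le
  · exact (EReal.div_le_div_right_of_nonneg hc.le (coverDim_mono href)).trans
      (coverDim_div_card_le T h𝓥)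

end Measure

/-! ### Free actions and covers with small orbit sums -/

section Action

variable [MetricSpace X] [Group Γ] (T : Γ →* (X ≃ₜ X))

/-- The translates of a family of sets, indexed by the group and the index set of the family. -/
def translates {S : Type*} (A : S → Set X) (p : Γ × S) : Set X := T p.1 ⁻¹' A p.2

theorem map_inv_apply (γ : Γ) (x : X) : T γ⁻¹ (T γ x) = x := by
  rw [← Homeomorph.mul_apply, ← map_mul, inv_mul_cancel, map_one]; rfl

theorem map_mul_apply (γ δ : Γ) (x : X) : T (γ * δ) x = T γ (T δ x) := by
  rw [map_mul]; rfl

/-- `O` meets none of its nontrivial translates. -/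
def DisjointTranslates (O : Set X) : Prop := ∀ γ x, x ∈ O → T γ x ∈ O → γ = 1

variable {T} [Fintype Γ]

theorem IsFreeAction.exists_isOpen_disjointTranslates (hT : IsFreeAction T) {𝓤 : Finset (Set X)}
    (h𝓤 : IsOpenCover 𝓤) (x : X) :
    ∃ O : Set X, IsOpen O ∧ x ∈ O ∧ DisjointTranslates T O ∧ ∀ γ, ∃ U ∈ 𝓤, O ⊆ T γ ⁻¹' U := by
  choose U hU hx using fun γ => h𝓤.2 (T γ x)
  have h1 : ∀ᶠ y in 𝓝 x, ∀ γ, T γ y ∈ U γ := eventually_all.2 fun γ =>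
    (T γ).continuous.continuousAt.eventually_mem ((h𝓤.1 _ (hU γ)).mem_nhds (hx γ))
  -- Stated for pairs near `(x, x)`, so that one neighbourhood serves both coordinates.
  have h2 : ∀ᶠ p in 𝓝 x ×ˢ 𝓝 x, ∀ γ, γ ≠ 1 → T γ p.1 ≠ p.2 := by
    rw [← nhds_prod_eq]
    refine eventually_all.2 fun γ => ?_
    by_cases hγ : γ = 1
    · simp [hγ]
    · have hne : T γ x ≠ x := by simpa using hT x γ 1 hγ
      have hc : IsOpen {p : X × X | T γ p.1 ≠ p.2} :=
        isOpen_ne_fun ((T γ).continuous.comp continuous_fst) continuous_snd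
      filter_upwards [hc.mem_nhds (show (x, x) ∈ {p : X × X | T γ p.1 ≠ p.2} from hne)] with p hp _
        using hp
  obtain ⟨t, ht, ht'⟩ := (eventually_prod_self_iff (r := fun y z => ∀ γ, γ ≠ 1 → T γ y ≠ z)).1 h2
  obtain ⟨O, hO, hOo, hxO⟩ := mem_nhds_iff.1 (inter_mem h1 ht)
  refine ⟨O, hOo, hxO, fun γ y hy hγy => ?_, fun γ => ⟨U γ, hU γ, fun y hy => (hO hy).1 γ⟩⟩
  by_contra hγ
  exact ht' y (hO hy).2 _ (hO hγy).2 γ hγ rfl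

/-- An open family whose translates cover can be shrunk so that the multiplicity of the translates
over a closed set `C` is at most `n`, provided that a neighbourhood of `C` meets none of its
translates. -/
theorem exists_shrinking_translates_on {n : ℕ}
    (H : ∀ 𝓤 : Finset (Set X), IsOpenCover 𝓤 → ∃ 𝓥 : Finset (Set X), IsOpenCover 𝓥 ∧
      Refines (𝓥 : Set (Set X)) 𝓤 ∧ ∀ x, multAt (fun V : 𝓥 => (V : Set X)) x ≤ n)
    {S : Type*} [Fintype S] {A : S → Set X} (hA : ∀ s, IsOpen (A s))
    (hcov : ∀ x, ∃ p, x ∈ translates T A p) {C O : Set X} (hC : IsClosed C) (hO : IsOpen O)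
    (hCO : C ⊆ O) (hd : DisjointTranslates T O) :
    ∃ B : S → Set X, (∀ s, IsOpen (B s)) ∧ (∀ s, B s ⊆ A s) ∧
      (∀ x, ∃ p, x ∈ translates T B p) ∧ ∀ x ∈ C, multAt (translates T B) x ≤ n := by
  obtain ⟨V, hVo, hVA, hVcov, hVn⟩ := exists_shrinking_of_exists_refinement H
    (fun p : Γ × S => (hA p.2).preimage (T p.1).continuous) hcov
  let D : Set X := ⋃ γ, T γ '' C
  have hD : IsClosed D := isClosed_iUnion_of_finite fun γ => (T γ).isClosedMap _ hC
  -- The sets `V (γ, s)` need not be translates of a single set, but near `C` this can be arranged: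
  -- the sets `T γ '' O` are disjoint, so the pieces of `V` on `O` can be transported independently.
  -- Over `C` the translates of the new family then lie in `V`.
  refine ⟨fun s => (A s \ D) ∪ ⋃ γ, T γ '' (V (γ, s) ∩ O), fun s => ?_, fun s => ?_, fun x => ?_,
    fun x hx => (multAt_mono fun p hp => ?_).trans (hVn x)⟩
  · exact ((hA s).sdiff hD).union
      (isOpen_iUnion fun γ => (T γ).isOpenMap _ ((hVo _).inter hO))
  · refine Set.union_subset Set.sdiff_subset (Set.iUnion_subset fun γ => ?_)
    rintro _ ⟨y, hy, rfl⟩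
    exact hVA (γ, s) hy.1
  · by_cases hx : x ∈ D
    · obtain ⟨γ, y, hy, rfl⟩ := Set.mem_iUnion.1 hx
      obtain ⟨⟨δ, s⟩, hyV⟩ := hVcov y
      refine ⟨(δ * γ⁻¹, s), Or.inr (Set.mem_iUnion.2 ⟨δ, y, ⟨hyV, hCO hy⟩, ?_⟩)⟩
      simp
    · obtain ⟨⟨γ, s⟩, hxs⟩ := hcov x
      refine ⟨(γ, s), Or.inl ⟨hxs, fun hγx => hx ?_⟩⟩
      obtain ⟨δ, y, hy, hyx⟩ := Set.mem_iUnion.1 hγx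
      refine Set.mem_iUnion.2 ⟨γ⁻¹ * δ, y, hy, ?_⟩
      rw [map_mul_apply, hyx]
      exact map_inv_apply T γ x
  · obtain ⟨γ, s⟩ := p
    rcases hp with hp | hp
    · exact (hp.2 (Set.mem_iUnion.2 ⟨γ, x, hx, rfl⟩)).elim
    · obtain ⟨δ, y, hy, hyx⟩ := Set.mem_iUnion.1 hp
      have hyx' : T δ y = T γ x := hyx
      have hTy : T (δ⁻¹ * γ) x = y := by
        rw [map_mul_apply, ← hyx', map_inv_apply]
      have h1 := hd _ x (hCO hx) (hTy ▸ hy.2)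
      obtain rfl : δ = γ := inv_mul_eq_one.1 h1
      obtain rfl : y = x := (T δ).injective hyx'
      exact hy.1

/-- Treat the closed sets one at a time; later shrinkings preserve the bounds already obtained. -/
theorem exists_shrinking_translates {n : ℕ}
    (H : ∀ 𝓤 : Finset (Set X), IsOpenCover 𝓤 → ∃ 𝓥 : Finset (Set X), IsOpenCover 𝓥 ∧
      Refines (𝓥 : Set (Set X)) 𝓤 ∧ ∀ x, multAt (fun V : 𝓥 => (V : Set X)) x ≤ n)
    {S : Type*} [Fintype S] {A : S → Set X} (hA : ∀ s, IsOpen (A s))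
    (hcov : ∀ x, ∃ p, x ∈ translates T A p) {ι : Type*} (t : Finset ι) {C O : ι → Set X}
    (hC : ∀ i, IsClosed (C i)) (hO : ∀ i, IsOpen (O i)) (hCO : ∀ i, C i ⊆ O i)
    (hd : ∀ i, DisjointTranslates T (O i)) :
    ∃ B : S → Set X, (∀ s, IsOpen (B s)) ∧ (∀ s, B s ⊆ A s) ∧
      (∀ x, ∃ p, x ∈ translates T B p) ∧ ∀ i ∈ t, ∀ x ∈ C i, multAt (translates T B) x ≤ n := by
  classical
  induction t using Finset.induction_on with
  | empty => exact ⟨A, hA, fun _ => le_rfl, hcov, by simp⟩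
  | insert i t _ ih =>
    obtain ⟨B, hB, hBA, hBcov, hBn⟩ := ih
    obtain ⟨B', hB', hBB', hBcov', hBn'⟩ :=
      exists_shrinking_translates_on H hB hBcov (hC i) (hO i) (hCO i) (hd i)
    refine ⟨B', hB', fun s => (hBB' s).trans (hBA s), hBcov', fun j hj x hx => ?_⟩
    rcases Finset.mem_insert.1 hj with rfl | hj
    · exact hBn' x hx
    · exact (multAt_mono fun p hp => hBB' p.2 hp).trans (hBn j hj x hx)

theorem exists_continuous_pos_iff_mem {A : Set X} (hA : IsOpen A) :
    ∃ f : X → ℝ, Continuous f ∧ (∀ x, 0 ≤ f x) ∧ ∀ x, 0 < f x ↔ x ∈ A := by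
  rcases Set.eq_empty_or_nonempty Aᶜ with h | h
  · exact ⟨fun _ => 1, continuous_const, fun _ => zero_le_one, fun x => by
      simp [Set.compl_empty_iff.1 h]⟩
  · refine ⟨fun x => Metric.infDist x Aᶜ, Metric.continuous_infDist_pt _,
      fun _ => Metric.infDist_nonneg, fun x => ?_⟩
    rw [← hA.isClosed_compl.notMem_iff_infDist_pos h, Set.notMem_compl_iff]

/-- If the translates of a family of sets with pairwise disjoint translates have multiplicity at
most `n + 1`, then there is an open cover finer than the translates whose multiplicities sum to at
most `|Γ| + n` along every orbit. -/
theorem exists_cover_sum_multAt_le [CompactSpace X] [Nonempty X] {S : Type*} [Fintype S]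
    {A : S → Set X} (hA : ∀ s, IsOpen (A s)) (hcov : ∀ x, ∃ p, x ∈ translates T A p)
    (hd : ∀ s, DisjointTranslates T (A s)) {n : ℕ}
    (hn : ∀ x, multAt (translates T A) x ≤ n + 1) :
    ∃ V : Γ × S → Set X, (∀ p, IsOpen (V p)) ∧ (∀ p, V p ⊆ translates T A p) ∧
      (∀ x, ∃ p, x ∈ V p) ∧ ∀ x, ∑ γ, multAt V (T γ x) ≤ Fintype.card Γ + n := by
  classical
  choose φ hφc hφ0 hφA using fun s => exists_continuous_pos_iff_mem (hA s)
  obtain ⟨b, hb⟩ := exists_linearIndependent_rat_real (Γ × S)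
  let g : Γ × S → X → ℝ := fun p x => Real.exp (b p) * φ p.2 (T p.1 x)
  have hgc : ∀ p, Continuous (g p) := fun p =>
    continuous_const.mul ((hφc p.2).comp (T p.1).continuous)
  have hgA : ∀ p x, 0 < g p x ↔ x ∈ translates T A p := fun p x => by
    simp only [g, translates, Set.mem_preimage, ← hφA, mul_pos_iff_of_pos_left (Real.exp_pos _)]
  obtain ⟨x₀⟩ := ‹Nonempty X›
  have hne : (Finset.univ : Finset (Γ × S)).Nonempty := ⟨_, Finset.mem_univ (hcov x₀).choose⟩
  let M : X → ℝ := fun x => Finset.univ.sup' hne fun p => g p x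
  have hMc : Continuous M := Continuous.finset_sup'_apply hne fun p _ => hgc p
  have hgM : ∀ p x, g p x ≤ M x := fun p x =>
    Finset.le_sup' (fun p => g p x) (Finset.mem_univ p)
  have hMpos : ∀ x, 0 < M x := fun x =>
    ((hgA _ x).2 (hcov x).choose_spec).trans_le (hgM _ x)
  have hMg : ∀ x, ∃ p, g p x = M x := fun x => by
    obtain ⟨p, -, hp⟩ := Finset.exists_mem_eq_sup' hne fun p => g p x
    exact ⟨p, hp.symm⟩
  let h : Γ × (Γ × S) → X → ℝ := fun q x => M (T q.1 x) - g q.2 (T q.1 x)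
  have key : ∀ x, multAt (fun q => {x | h q x = 0}) x ≤ Fintype.card Γ + n := by
    -- Edges `ε` are the pairs `(δ, (γ, s))` for which `g (γ, s)` is maximal at `T δ x`; such an
    -- edge joins `δ` to the translate `(γ * δ, s)`, which contains `x`.
    intro x
    let β := {p : Γ × S // x ∈ translates T A p}
    let ε := {q : Γ × (Γ × S) // h q x = 0}
    have hβ : Fintype.card β ≤ n + 1 := by
      rw [← multAt_eq_card]; exact hn x
    have : Nonempty β := ⟨⟨_, (hcov x).choose_spec⟩⟩
    have hε0 : ∀ q : ε, g q.1.2 (T q.1.1 x) = M (T q.1.1 x) := fun q => (sub_eq_zero.1 q.2).symm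
    have hεA : ∀ q : ε, T (q.1.2.1 * q.1.1) x ∈ A q.1.2.2 := fun q => by
      have := (hgA q.1.2 (T q.1.1 x)).1 (hε0 q ▸ hMpos _)
      rwa [map_mul_apply]
    let e : ε → β := fun q => ⟨(q.1.2.1 * q.1.1, q.1.2.2), hεA q⟩
    -- Disjointness of translates recovers `δ` from `(γ, s)`, so distinct edges carry distinct
    -- independent weights.
    have hinj : Function.Injective fun q : ε => q.1.2 := by
      rintro ⟨⟨δ, γ, s⟩, hq⟩ ⟨⟨δ', γ', s'⟩, hq'⟩ heq
      obtain ⟨rfl, rfl⟩ := Prod.mk.inj (show (γ, s) = (γ', s') from heq)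
      have h1 : T (γ * δ) x ∈ A s := hεA ⟨_, hq⟩
      have h2 : T (γ * δ') x ∈ A s := hεA ⟨_, hq'⟩
      have h3 : T (γ * δ' * (γ * δ)⁻¹) (T (γ * δ) x) ∈ A s := by
        rwa [← map_mul_apply, inv_mul_cancel_right]
      have h4 := mul_inv_eq_one.1 (hd s _ _ h1 h3)
      obtain rfl := mul_left_cancel h4
      rfl
    have hlog : ∀ q : ε, Real.log (M (T q.1.1 x)) -
        Real.log (φ (e q).1.2 (T (e q).1.1 x)) = b q.1.2 := by
      intro q
      have hpos : 0 < φ (e q).1.2 (T (e q).1.1 x) := (hφA _ _).2 (hεA q)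
      rw [← hε0 q]
      have : g q.1.2 (T q.1.1 x) = Real.exp (b q.1.2) * φ (e q).1.2 (T (e q).1.1 x) := by
        simp only [g, e, map_mul_apply]
      rw [this, Real.log_mul (Real.exp_pos _).ne' hpos.ne', Real.log_exp, add_sub_cancel_right]
    have hcard := card_succ_le_of_linearIndependent_sub (fun q : ε => q.1.1) e
      (fun δ => Real.log (M (T δ x))) (fun p => Real.log (φ p.1.2 (T p.1.1 x)))
      (by simp only [hlog]; exact hb.comp _ hinj)
    have : multAt (fun q => {x | h q x = 0}) x = Fintype.card ε := multAt_eq_card _ _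
    omega
  have hhc : ∀ q, Continuous (h q) := fun q =>
    (hMc.comp (T q.1).continuous).sub ((hgc q.2).comp (T q.1).continuous)
  have hh0 : ∀ q x, 0 ≤ h q x := fun q x => sub_nonneg.2 (hgM q.2 (T q.1 x))
  obtain ⟨y, -, hy⟩ := isCompact_univ.exists_isMinOn ⟨x₀, Set.mem_univ _⟩ hMc.continuousOn
  -- Taking `r` below the minimum of `M` forces `g p > 0` on `V p`, hence `V p ⊆ translates T A p`.
  have hev : ∀ᶠ r in 𝓝[>] (0 : ℝ), r ∈ Set.Ioo 0 (M y) := Ioo_mem_nhdsGT (hMpos y)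
  obtain ⟨r, hr, hr0, hrM⟩ := ((eventually_multAt_lt_le hhc hh0 key).and hev).exists
  let V : Γ × S → Set X := fun p => {x | M x - g p x < r}
  have hV : ∀ p x, x ∈ V p ↔ M x - g p x < r := fun _ _ => Iff.rfl
  refine ⟨V, ?_, ?_, ?_, ?_⟩
  · intro p
    exact isOpen_lt (hMc.sub (hgc p)) continuous_const
  · intro p x hx
    rw [← hgA]
    have h1 := (hV p x).1 hx
    have h2 : M y ≤ M x := hy (Set.mem_univ x)
    linarith
  · intro x
    obtain ⟨p, hp⟩ := hMg x
    exact ⟨p, (hV p x).2 (by rwa [hp, sub_self])⟩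
  · intro x
    refine le_trans (le_of_eq ?_) (hr x)
    rw [multAt_prod]
    rfl

/-- For a free action, a space of dimension at most `n` has arbitrarily fine open covers whose
multiplicities sum to at most `|Γ| + n` along every orbit. -/
theorem exists_refinement_sum_multAt_le [CompactSpace X] [Nonempty X] (hT : IsFreeAction T) {n : ℕ}
    (H : ∀ 𝓤 : Finset (Set X), IsOpenCover 𝓤 → ∃ 𝓥 : Finset (Set X), IsOpenCover 𝓥 ∧
      Refines (𝓥 : Set (Set X)) 𝓤 ∧ ∀ x, multAt (fun V : 𝓥 => (V : Set X)) x ≤ n + 1)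
    {𝓤 : Finset (Set X)} (h𝓤 : IsOpenCover 𝓤) :
    ∃ 𝓥 : Finset (Set X), IsOpenCover 𝓥 ∧ Refines (𝓥 : Set (Set X)) 𝓤 ∧
      ∀ x, ∑ γ, multAt (fun V : 𝓥 => (V : Set X)) (T γ x) ≤ Fintype.card Γ + n := by
  classical
  choose O hOo hxO hOd hOU using hT.exists_isOpen_disjointTranslates h𝓤
  choose C hCx hCc hCO using fun x =>
    exists_mem_nhds_isClosed_subset ((hOo x).mem_nhds (hxO x))
  obtain ⟨t, ht⟩ := CompactSpace.elim_nhds_subcover C hCx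
  have htC : ∀ x, ∃ i ∈ t, x ∈ C i := fun x => by
    have := ht.ge (Set.mem_univ x)
    simpa using this
  obtain ⟨A, hAo, hAO, hAcov, hAn⟩ := exists_shrinking_translates (T := T) H
    (A := fun s : t => O s) (fun s => hOo s)
    (fun x => by
      obtain ⟨i, hi, hx⟩ := htC x
      exact ⟨(1, ⟨i, hi⟩), by simpa [translates] using hCO i hx⟩)
    t hCc hOo hCO hOd
  obtain ⟨V, hVo, hVA, hVcov, hVn⟩ := exists_cover_sum_multAt_le (T := T) hAo hAcov
    (fun s γ x hx hγx => hOd s γ x (hAO s hx) (hAO s hγx))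
    (fun x => by
      obtain ⟨i, hi, hx⟩ := htC x
      exact hAn i hi x hx)
  refine ⟨Finset.univ.image V, isOpenCover_image hVo hVcov, fun W hW => ?_, fun x =>
    (Finset.sum_le_sum fun γ _ => multAt_coe_image_le V (T γ x)).trans (hVn x)⟩
  obtain ⟨⟨γ, s⟩, rfl⟩ : ∃ p, V p = W := by simpa using hW
  obtain ⟨U, hU, hOU⟩ := hOU s γ⁻¹
  refine ⟨U, hU, fun x hx => ?_⟩
  have := hOU (hAO s (hVA (γ, s) hx))
  simpa [map_inv_apply] using this

end Action

/-! ### From covering dimension to the dynamical upper bound -/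

theorem exists_refinement_multAt_le_of_coveringDim_ne_top [TopologicalSpace X] [Nonempty X]
    (hX : coveringDim X ≠ ⊤) :
    ∃ n : ℕ, ((n : ℝ) : EReal) ≤ coveringDim X ∧ ∀ 𝓤 : Finset (Set X), IsOpenCover 𝓤 →
      ∃ 𝓥 : Finset (Set X), IsOpenCover 𝓥 ∧ Refines (𝓥 : Set (Set X)) 𝓤 ∧
        ∀ x, multAt (fun V : 𝓥 => (V : Set X)) x ≤ n + 1 := by
  have h0 : 0 ≤ coveringDim X := by
    refine le_trans ?_ (coverDim_le_coveringDim (𝓤 := {Set.univ}) ⟨by simp, by simp⟩)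
    refine le_iInf₂ fun 𝓥 h𝓥 => le_iInf fun _ => ?_
    obtain ⟨x⟩ := ‹Nonempty X›
    refine le_iSup_of_le x ?_
    obtain ⟨V, hV, hx⟩ := h𝓥.2 x
    rw [ordAt_eq, EReal.coe_nonneg, sub_nonneg]
    exact_mod_cast multAt_pos (A := fun V : 𝓥 => (V : Set X)) (j := ⟨V, hV⟩) hx
  lift coveringDim X to ℝ using ⟨hX, (bot_lt_iff_ne_bot.1 (EReal.bot_lt_zero.trans_le h0))⟩
    with r hr
  have hr0 : 0 ≤ r := by exact_mod_cast h0
  -- Multiplicities are integers, so an order below `⌊r⌋₊ + 1` is at most `⌊r⌋₊`; the integrality of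
  -- the dimension itself is not needed.
  refine ⟨⌊r⌋₊, by exact_mod_cast Nat.floor_le hr0, fun 𝓤 h𝓤 => ?_⟩
  have hlt : coverDim (𝓤 : Set (Set X)) < ((⌊r⌋₊ + 1 : ℝ) : EReal) :=
    ((coverDim_le_coveringDim h𝓤).trans hr.ge).trans_lt
      (by exact_mod_cast Nat.lt_floor_add_one r)
  simp only [coverDim, iInf_lt_iff] at hlt
  obtain ⟨𝓥, h𝓥, href, hlt⟩ := hlt
  refine ⟨𝓥, h𝓥, href, fun x => ?_⟩
  have h1 := (le_iSup (fun x => (ordAt 𝓥 x : EReal)) x).trans_lt hlt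
  rw [EReal.coe_lt_coe_iff, ordAt_eq, sub_lt_iff_lt_add] at h1
  have h2 : multAt (fun V : 𝓥 => (V : Set X)) x < ⌊r⌋₊ + 1 + 1 := by exact_mod_cast h1
  omega

theorem dimSystem_le_coveringDim_div_card [MetricSpace X] [CompactSpace X] [MeasurableSpace X]
    [BorelSpace X] [Group Γ] [Fintype Γ] {T : Γ →* (X ≃ₜ X)} (hT : IsFreeAction T) :
    dimSystem T ≤ coveringDim X / (Fintype.card Γ : EReal) := by
  have hc : (0 : EReal) < Fintype.card Γ := by exact_mod_cast Fintype.card_pos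
  refine iSup₂_le fun 𝓤 h𝓤 => ?_
  rcases isEmpty_or_nonempty X with hX | hX
  · refine (iInf₂_le_of_le 𝓤 h𝓤 (iInf_le_of_le (fun V hV => ⟨V, hV, le_rfl⟩) ?_)).trans bot_le
    refine iSup₂_le fun μ _ => ?_
    have := (μ : ProbabilityMeasure X).nonempty
    exact (not_isEmpty_of_nonempty X hX).elim
  by_cases htop : coveringDim X = ⊤
  · rw [htop, EReal.top_div_of_pos_ne_top hc (EReal.natCast_ne_top _)]
    exact le_top
  obtain ⟨n, hn, H⟩ := exists_refinement_multAt_le_of_coveringDim_ne_top htop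
  obtain ⟨𝓥, h𝓥, href, hsum⟩ := exists_refinement_sum_multAt_le hT H h𝓤
  refine iInf₂_le_of_le 𝓥 h𝓥 (iInf_le_of_le href (iSup₂_le fun μ hμ => ?_))
  refine le_trans ?_ (EReal.div_le_div_right_of_nonneg hc.le hn)
  have hle := integral_ordAt_le_of_mem_invProb T h𝓥 hμ (r := n) fun x => by
    simp only [ordAt_eq, Finset.sum_sub_distrib]
    have : (∑ γ, (multAt (fun V : 𝓥 => (V : Set X)) (T γ x) : ℝ)) ≤ Fintype.card Γ + n := by
      exact_mod_cast hsum x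
    simpa [add_comm] using this
  have := EReal.coe_le_coe_iff.2 hle
  rwa [EReal.coe_div, EReal.coe_natCast (n := Fintype.card Γ)] at this

end MeasDim

theorem theorem7p1 {Γ : Type*} [Group Γ] [Finite Γ]
    {X : Type*} [MetricSpace X] [CompactSpace X] [MeasurableSpace X] [BorelSpace X]
    (T : Γ →* (X ≃ₜ X)) (hT : MeasDim.IsFreeAction T) :
    MeasDim.dimSystem T = MeasDim.coveringDim X / (Nat.card Γ : EReal) ∧
    ∀ F : ℕ → Finset Γ, MeasDim.IsFolnerSeq F →
      (∀ 𝓤 : Finset (Set X), MeasDim.IsOpenCover 𝓤 →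
        ∃ l : EReal, Tendsto (fun n => MeasDim.avgCoverDim T (𝓤 : Set (Set X)) (F n))
          atTop (𝓝 l)) ∧
      MeasDim.meanDim T F = MeasDim.dimSystem T := by
  have := Fintype.ofFinite Γ
  have h : MeasDim.dimSystem T = MeasDim.coveringDim X / (Fintype.card Γ : EReal) :=
    (MeasDim.dimSystem_le_coveringDim_div_card hT).antisymm
      (MeasDim.coveringDim_div_card_le_dimSystem T)
  rw [Nat.card_eq_fintype_card]
  exact ⟨h, fun F hF => ⟨fun 𝓤 _ => ⟨_, MeasDim.tendsto_avgCoverDim T hF _⟩,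
    (MeasDim.meanDim_eq_coveringDim_div T hF).trans h.symm⟩⟩
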